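/- Let $m,n\ge 1$. For a real tensor $\mathcal A=(a_{i_1\cdots i_m})$ of order $m$ and dimension $n$ put $\mathcal A\mathbf x^m=\sum_{i_1,\dots,i_m=1}^n a_{i_1\cdots i_m}x_{i_1}\cdots x_{i_m}$. Call $\mathcal A$ symmetric if its entries are invariant under permutations of the indices, and copositive if $\mathcal A\mathbf x^m\ge 0$ for all $\mathbf x\in\mathbb R^n$ with nonnegative coordinates. A symmetric tensor $\mathcal A$ is an extended $Z$-tensor if, writing $\mathcal A\mathbf x^m=\sum_{|\alpha|=m}f_\alpha\mathbf x^\alpha$, there are $s\le n$ and pairwise disjoint sets $\Gamma_1,\dots,\Gamma_s$ with union $\{1,\dots,n\}$ such that $$\mathcal A\mathbf x^m=\sum_{i=1}^n f_{m\mathbf e_i}x_i^m+\sum_{l=1}^s\sum_{\alpha\in\Omega_l}f_\alpha\mathbf x^\alpha ,$$ where $\Omega_l$ is the set of exponents $\alpha\in\mathbb Z_{\ge0}^n$ with $|\alpha|=m$, with support contained in $\Gamma_l$, and with $\alpha\ne m\mathbf e_i$ for all $i$, and such that for each $l$ either $f_\alpha\neq0$ for at most one $\alpha\in\Omega_l$,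 or $f_\alpha\le0$ for all $\alpha\in\Omega_l$. Let $\mathcal A$ be a symmetric extended $Z$-tensor of order $m$ (odd or even) and dimension $n$, and let $\mathcal A_h$ be the symmetric tensor of order $2m$ and dimension $n$ with $\mathcal A_h\mathbf x^{2m}=\sum_{i_1,\dots,i_m=1}^n a_{i_1\cdots i_m}x_{i_1}^2\cdots x_{i_m}^2$. Then the minimum $$v=\min_{t\in\mathbb R}\Big\{t : t\sum_{i=1}^n x_i^{2m}+\mathcal A_h\mathbf x^{2m}\ \text{is a sum of squares of real polynomials}\Big\}$$ is attained, and $\mathcal A$ is copositive if and only if $v\le0$. -/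

import Mathlib

open MvPolynomial

noncomputable section

/-- A real tensor of order `m` and dimension `n`: the array of its entries `a_{i₁ ⋯ i_m}`. -/
abbrev Tensor (m n : ℕ) : Type := (Fin m → Fin n) → ℝ

namespace Tensor

variable {m n : ℕ}

/-- The entries are invariant under every permutation of the indices. -/
def IsSymm (A : Tensor m n) : Prop :=
  ∀ (σ : Equiv.Perm (Fin m)) (i : Fin m → Fin n), A (i ∘ σ) = A i

/-- The homogeneous polynomial `A x^m = ∑ a_{i₁ ⋯ i_m} x_{i₁} ⋯ x_{i_m}`. -/
def form (A : Tensor m n) : MvPolynomial (Fin n) ℝ :=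
  ∑ i : Fin m → Fin n, C (A i) * ∏ k, X (i k)

/-- `A x^m ≥ 0` on the nonnegative orthant. -/
def IsCopositive (A : Tensor m n) : Prop :=
  ∀ x : Fin n → ℝ, (∀ i, 0 ≤ x i) → 0 ≤ eval x A.form

/-- The exponents `α` with `|α| = m` of the monomials in the variables `x_i`, `i ∈ Γ`, other than
the pure powers `x_i^m`. -/
def mixedExponents (m : ℕ) (Γ : Finset (Fin n)) : Finset (Fin n →₀ ℕ) :=
  {α ∈ Γ.finsuppAntidiag m | ∀ i, α ≠ Finsupp.single i m}

/-- Extended `Z`-tensors: the index set is partitioned into blocks `Γ_l`, no monomial of `A x^m`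
involves variables of two blocks, and in each block either at most one mixed monomial has a nonzero
coefficient or all the mixed monomials have nonpositive coefficients. -/
def IsExtendedZ (A : Tensor m n) : Prop :=
  A.IsSymm ∧ ∃ s : ℕ, s ≤ n ∧ ∃ Γ : Fin s → Finset (Fin n),
    (∀ i, ∃ l, i ∈ Γ l) ∧
    (∀ l₁ l₂, l₁ ≠ l₂ → Disjoint (Γ l₁) (Γ l₂)) ∧
    A.form = ∑ i, monomial (Finsupp.single i m) (coeff (Finsupp.single i m) A.form) +
      ∑ l, ∑ α ∈ mixedExponents m (Γ l), monomial α (coeff α A.form) ∧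
    ∀ l, (∃ β, ∀ α ∈ mixedExponents m (Γ l), α ≠ β → coeff α A.form = 0) ∨
      (∀ α ∈ mixedExponents m (Γ l), coeff α A.form ≤ 0)

/-- The index `(i₁, i₁, i₂, i₂, …, i_m, i_m)`. -/
def doubleIndex (i : Fin m → Fin n) : Fin (2 * m) → Fin n :=
  fun p => i ⟨p / 2, by omega⟩

/-- The symmetric tensor `A_h` of order `2m` with
`A_h x^{2m} = ∑ a_{i₁ ⋯ i_m} x_{i₁}² ⋯ x_{i_m}²` (see `form_squared` and `isSymm_squared`): the
symmetrization of the array that has the entry `a_{i₁ ⋯ i_m}` at `(i₁, i₁, …, i_m, i_m)` and zeros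
elsewhere. -/
def squared (A : Tensor m n) : Tensor (2 * m) n := fun j =>
  (∑ σ : Equiv.Perm (Fin (2 * m)), ∑ i : Fin m → Fin n,
    if j ∘ σ = doubleIndex i then A i else 0) / ((2 * m).factorial : ℝ)

theorem isSymm_squared (A : Tensor m n) : A.squared.IsSymm := by
  intro τ j
  unfold squared
  congr 1
  exact Fintype.sum_equiv (Equiv.mulLeft τ) _ _ fun σ => rfl

theorem prod_doubleIndex {R : Type*} [CommMonoid R] (x : Fin n → R) (i : Fin m → Fin n) :
    ∏ p, x (doubleIndex i p) = ∏ k, x (i k) ^ 2 := by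
  have h := Fintype.prod_equiv (finProdFinEquiv.trans (finCongr (mul_comm m 2)))
    (fun q : Fin m × Fin 2 => x (i q.1)) (fun p => x (doubleIndex i p)) (by
      rintro ⟨k, r⟩
      unfold doubleIndex
      congr 2
      ext
      simp
      omega)
  rw [← h, Fintype.prod_prod_type]
  simp

theorem form_squared (A : Tensor m n) :
    A.squared.form = ∑ i : Fin m → Fin n, C (A i) * ∏ k, (X (i k) : MvPolynomial (Fin n) ℝ) ^ 2 := by
  have key : ∀ σ : Equiv.Perm (Fin (2 * m)),
      (∑ j : Fin (2 * m) → Fin n, ∑ i : Fin m → Fin n,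
        C (if j ∘ σ = doubleIndex i then A i else 0) * ∏ p, (X (j p) : MvPolynomial (Fin n) ℝ)) =
      ∑ i : Fin m → Fin n, C (A i) * ∏ k, (X (i k) : MvPolynomial (Fin n) ℝ) ^ 2 := by
    intro σ
    rw [Finset.sum_comm]
    refine Finset.sum_congr rfl fun i _ => ?_
    rw [Finset.sum_eq_single (doubleIndex i ∘ σ.symm)]
    · rw [if_pos (by funext p; simp), ← prod_doubleIndex]
      congr 1
      exact Fintype.prod_equiv σ.symm _ _ fun p => rfl
    · intro j _ hj
      rw [if_neg, C_0, zero_mul]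
      intro h
      apply hj
      rw [← h]
      funext p
      simp
    · simp
  have hf : ((2 * m).factorial : ℝ) ≠ 0 := by positivity
  unfold form squared
  simp only [div_eq_mul_inv, C_mul, map_sum, Finset.sum_mul]
  rw [Finset.sum_comm]
  have : ∀ σ : Equiv.Perm (Fin (2 * m)),
      (∑ j : Fin (2 * m) → Fin n, ∑ i : Fin m → Fin n,
        C (if j ∘ σ = doubleIndex i then A i else 0) * C ((2 * m).factorial : ℝ)⁻¹ *
          ∏ p, (X (j p) : MvPolynomial (Fin n) ℝ)) =
      C ((2 * m).factorial : ℝ)⁻¹ *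
        ∑ i : Fin m → Fin n, C (A i) * ∏ k, (X (i k) : MvPolynomial (Fin n) ℝ) ^ 2 := by
    intro σ
    rw [← key σ, Finset.mul_sum]
    refine Finset.sum_congr rfl fun j _ => ?_
    rw [Finset.mul_sum]
    exact Finset.sum_congr rfl fun i _ => by ring
  rw [Finset.sum_congr rfl fun σ _ => this σ, Finset.sum_const, Finset.card_univ,
    Fintype.card_perm, Fintype.card_fin, nsmul_eq_mul, ← mul_assoc,
    ← map_natCast (C : ℝ →+* MvPolynomial (Fin n) ℝ), ← C_mul, mul_inv_cancel₀ hf, C_1, one_mul]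

end Tensor

/-- The sums of squares of real polynomials in `n` variables, of degree at most `d`. -/
def sosPolynomials (n d : ℕ) : Set (MvPolynomial (Fin n) ℝ) :=
  {p | p.totalDegree ≤ d ∧
    ∃ (r : ℕ) (q : Fin r → MvPolynomial (Fin n) ℝ), p = ∑ k, q k ^ 2}

/-- `‖x‖_d^d = ∑ |x_i|^d` as a polynomial; used only for even `d`, where `|x_i|^d = x_i^d`. -/
def normPow (n d : ℕ) : MvPolynomial (Fin n) ℝ := ∑ i, X i ^ d

end

/-! ### Sums of squares and the arithmetic-geometric mean inequality. -/

section SumsOfSquares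

variable {R : Type*} [CommRing R] [Algebra ℝ R]

/-! For extended Z-tensors, nonnegativity on the orthant already forces the form in squared
variables to be a sum of squares (`isSumSq_of_copositive`). A positive mixed monomial shares no
variable with any other nonzero mixed monomial. Setting its variables to zero shows that the
diagonal dominates the negative monomials alone; the positive ones are sums of squares once squares
are substituted. By Hahn-Banach separation (`exists_weights_sum_le`), the diagonal can then be
shared out so that each negative monomial is dominated by its own share. Each such one-monomial
inequality is a rescaled arithmetic-geometric mean inequality, which Hurwitz's identity turns into a
sum of squares. Adding t to every diagonal coefficient preserves the hypotheses, so the feasible t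
are cut out by closed conditions, affine in t with nonnegative slope: they form a closed up-set,
nonempty and bounded below, and copositivity says that it contains 0. -/

theorem isSumSq_algebraMap {c : ℝ} (hc : 0 ≤ c) : IsSumSq (algebraMap ℝ R c) := by
  have h := IsSumSq.mul_self (algebraMap ℝ R (√c))
  rwa [← map_mul, Real.mul_self_sqrt hc] at h

theorem IsSumSq.of_algebraMap_mul {c : ℝ} (hc : 0 < c) {x : R}
    (h : IsSumSq (algebraMap ℝ R c * x)) : IsSumSq x := by
  have h' := (isSumSq_algebraMap (R := R) (inv_nonneg.2 hc.le)).mul h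
  rwa [← mul_assoc, ← map_mul, inv_mul_cancel₀ hc.ne', map_one, one_mul] at h'

theorem IsSumSq.pow {S : Type*} [CommSemiring S] {x : S} (hx : IsSumSq x) (k : ℕ) :
    IsSumSq (x ^ k) := by
  induction k with
  | zero => simp
  | succ k ih => rw [pow_succ]; exact ih.mul hx

theorem IsSumSq.exists_eq_sum_fin {S : Type*} [CommSemiring S] {x : S} (hx : IsSumSq x) :
    ∃ (r : ℕ) (q : Fin r → S), x = ∑ k, q k ^ 2 := by
  induction hx with
  | zero => exact ⟨0, Fin.elim0, by simp⟩
  | sq_add a _ ih =>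
    obtain ⟨r, q, rfl⟩ := ih
    exact ⟨r + 1, Fin.cons a q, by simp [Fin.sum_univ_succ, sq]⟩

/-- The second factor is divisible by `a - b`; what remains is a square times a sum of products of
powers of `a` and `b`. -/
theorem isSumSq_sub_mul_pow_sub_pow {S : Type*} [CommRing S] {a b : S} (ha : IsSumSq a)
    (hb : IsSumSq b) (k : ℕ) : IsSumSq ((a - b) * (a ^ k - b ^ k)) := by
  have h : (a - b) * (a ^ k - b ^ k) =
      ((a - b) * (a - b)) * ∑ i ∈ Finset.range k, a ^ i * b ^ (k - 1 - i) := by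
    rw [← (Commute.all a b).mul_geom_sum₂ k]
    ring
  rw [h]
  exact (IsSumSq.mul_self _).mul (IsSumSq.sum fun i _ => (ha.pow _).mul (hb.pow _))

/-- **Hurwitz**: the arithmetic-geometric mean inequality, as a sum of squares. -/
theorem isSumSq_sum_pow_card_sub_prod {κ : Type*} [DecidableEq κ] (a : κ → R)
    (ha : ∀ k, IsSumSq (a k)) (s : Finset κ) :
    IsSumSq (∑ k ∈ s, a k ^ s.card - (s.card : R) * ∏ k ∈ s, a k) := by
  obtain ⟨d, hd⟩ : ∃ d, s.card = d := ⟨_, rfl⟩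
  induction d generalizing s with
  | zero => simp [Finset.card_eq_zero.1 hd]
  | succ d ih =>
    rcases Nat.eq_zero_or_pos d with rfl | hpos
    · obtain ⟨k, rfl⟩ := Finset.card_eq_one.1 hd
      simp
    -- In `h1 + 2 * h2` the terms `(∑ a) * ∑ a ^ d` cancel, leaving `2 * d` times the claim; hence
    -- the separate case `d = 0`.
    have h1 : IsSumSq (∑ j ∈ s, ∑ k ∈ s, (a j - a k) * (a j ^ d - a k ^ d)) :=
      IsSumSq.sum fun j _ => IsSumSq.sum fun k _ => isSumSq_sub_mul_pow_sub_pow (ha j) (ha k) d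
    have h2 : IsSumSq (∑ j ∈ s, a j * (∑ k ∈ s.erase j, a k ^ d - d * ∏ k ∈ s.erase j, a k)) := by
      refine IsSumSq.sum fun j hj => (ha j).mul ?_
      have hc : (s.erase j).card = d := by rw [Finset.card_erase_of_mem hj, hd]; rfl
      simpa only [hc] using ih (s.erase j) hc
    have e1 : ∑ j ∈ s, ∑ k ∈ s, (a j - a k) * (a j ^ d - a k ^ d) =
        2 * (d + 1) * ∑ k ∈ s, a k ^ (d + 1) - 2 * ((∑ j ∈ s, a j) * ∑ k ∈ s, a k ^ d) := by
      have : ∀ j k, (a j - a k) * (a j ^ d - a k ^ d) =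
          a j ^ (d + 1) + a k ^ (d + 1) - a j * a k ^ d - a j ^ d * a k := fun j k => by ring
      simp only [this, Finset.sum_sub_distrib, Finset.sum_add_distrib, ← Finset.mul_sum,
        ← Finset.sum_mul, Finset.sum_const, hd, nsmul_eq_mul]
      push_cast
      ring
    have e2 : ∑ j ∈ s, a j * (∑ k ∈ s.erase j, a k ^ d - d * ∏ k ∈ s.erase j, a k) =
        (∑ j ∈ s, a j) * ∑ k ∈ s, a k ^ d - ∑ k ∈ s, a k ^ (d + 1) -
          d * (d + 1) * ∏ k ∈ s, a k := by
      have : ∀ j ∈ s, a j * (∑ k ∈ s.erase j, a k ^ d - d * ∏ k ∈ s.erase j, a k) =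
          a j * ∑ k ∈ s, a k ^ d - a j ^ (d + 1) - d * ∏ k ∈ s, a k := fun j hj => by
        rw [← Finset.add_sum_erase s _ hj, ← Finset.mul_prod_erase s _ hj]
        ring
      rw [Finset.sum_congr rfl this]
      simp only [Finset.sum_sub_distrib, ← Finset.sum_mul, Finset.sum_const, hd, nsmul_eq_mul]
      push_cast
      ring
    refine IsSumSq.of_algebraMap_mul (c := 2 * d) (by positivity) ?_
    refine Eq.mp (congrArg (fun z : R => IsSumSq z) ?_) (h1.add (h2.add h2))
    rw [e1, e2, hd]
    simp only [map_mul, map_natCast, map_ofNat]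
    push_cast
    ring

/-- This is the unweighted inequality with each `a i` repeated `α i` times. -/
theorem isSumSq_weighted_sum_pow_sub_prod {ι : Type*} [Fintype ι] (a : ι → R)
    (ha : ∀ i, IsSumSq (a i)) {m : ℕ} {α : ι → ℕ} (hα : ∑ i, α i = m) :
    IsSumSq (∑ i, (α i : R) * a i ^ m - (m : R) * ∏ i, a i ^ α i) := by
  classical
  have h := isSumSq_sum_pow_card_sub_prod (fun p : (i : ι) × Fin (α i) => a p.1)
    (fun p => ha p.1) Finset.univ
  have hc : (Finset.univ : Finset ((i : ι) × Fin (α i))).card = m := by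
    simp [← hα]
  rw [hc, Fintype.sum_sigma, Fintype.prod_sigma] at h
  simpa using h

end SumsOfSquares

/-! ### Weights for which the diagonal dominates a single monomial. -/

theorem card_mul_prod_pow_le {ι : Type*} [Fintype ι] {a : ι → ℝ} (ha : ∀ i, 0 ≤ a i) {m : ℕ}
    {α : ι → ℕ} (hα : ∑ i, α i = m) : m * ∏ i, a i ^ α i ≤ ∑ i, α i * a i ^ m :=
  sub_nonneg.1 (isSumSq_weighted_sum_pow_sub_prod a
    (fun i => isSumSq_algebraMap (R := ℝ) (ha i)) hα).nonneg

/-- The nonnegative weights `w` with `v ^ α ≤ ∑ w_i v_i ^ m` on the nonnegative orthant. -/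
def agmWeights {ι : Type*} [Fintype ι] (m : ℕ) (α : ι → ℕ) : Set (ι → ℝ) :=
  {w | (∀ i, 0 ≤ w i) ∧ ∀ v : ι → ℝ, (∀ i, 0 ≤ v i) → ∏ i, v i ^ α i ≤ ∑ i, w i * v i ^ m}

section Weights

variable {ι : Type*} [Fintype ι] {m : ℕ} {α : ι → ℕ}

theorem isClosed_agmWeights : IsClosed (agmWeights m α) := by
  have h : agmWeights m α = (⋂ i, {w | 0 ≤ w i}) ∩
      ⋂ v : ι → ℝ, ⋂ _ : ∀ i, 0 ≤ v i, {w | ∏ i, v i ^ α i ≤ ∑ i, w i * v i ^ m} := by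
    ext w
    simp [agmWeights]
  rw [h]
  refine IsClosed.inter (isClosed_iInter fun i => ?_)
    (isClosed_iInter fun v => isClosed_iInter fun _ => ?_)
  · exact isClosed_le continuous_const (continuous_apply i)
  · exact isClosed_le continuous_const (by fun_prop)

theorem convex_agmWeights : Convex ℝ (agmWeights m α) := by
  intro w hw w' hw' s t hs ht hst
  refine ⟨fun i => ?_, fun v hv => ?_⟩
  · have := hw.1 i
    have := hw'.1 i
    simp only [Pi.add_apply, Pi.smul_apply, smul_eq_mul]
    positivity
  · have h1 := mul_le_mul_of_nonneg_left (hw.2 v hv) hs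
    have h2 := mul_le_mul_of_nonneg_left (hw'.2 v hv) ht
    have h3 : ∑ i, (s • w + t • w') i * v i ^ m =
        s * ∑ i, w i * v i ^ m + t * ∑ i, w' i * v i ^ m := by
      rw [Finset.mul_sum, Finset.mul_sum, ← Finset.sum_add_distrib]
      refine Finset.sum_congr rfl fun i _ => ?_
      simp only [Pi.add_apply, Pi.smul_apply, smul_eq_mul]
      ring
    rw [h3]
    calc ∏ i, v i ^ α i = s * ∏ i, v i ^ α i + t * ∏ i, v i ^ α i := by
          rw [← add_mul, hst, one_mul]
      _ ≤ _ := add_le_add h1 h2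

/-- Apply the arithmetic-geometric mean inequality to `v i / y i`. Equality holds at `v = y`, which
is what the separation argument uses. -/
theorem tangent_mem_agmWeights (hm : 0 < m) (hα : ∑ i, α i = m) {y : ι → ℝ} (hy : ∀ i, 0 < y i) :
    (fun i => α i / m * (∏ j, y j ^ α j) / y i ^ m) ∈ agmWeights m α := by
  have hP : 0 < ∏ j, y j ^ α j := Finset.prod_pos fun j _ => pow_pos (hy j) _
  refine ⟨fun i => ?_, fun v hv => ?_⟩
  · have := hy i
    positivity
  · have h := card_mul_prod_pow_le (a := fun i => v i / y i)
      (fun i => div_nonneg (hv i) (hy i).le) hα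
    simp only [div_pow, Finset.prod_div_distrib] at h
    have hm' : (0 : ℝ) < m := by exact_mod_cast hm
    calc ∏ i, v i ^ α i
        = (∏ j, y j ^ α j) / m * (m * ((∏ i, v i ^ α i) / ∏ i, y i ^ α i)) := by
          field_simp
      _ ≤ (∏ j, y j ^ α j) / m * ∑ i, α i * (v i ^ m / y i ^ m) :=
          mul_le_mul_of_nonneg_left h (by positivity)
      _ = _ := by
          rw [Finset.mul_sum]
          refine Finset.sum_congr rfl fun i _ => ?_
          ring

theorem pos_of_mem_agmWeights {w : ι → ℝ} (hw : w ∈ agmWeights m α) {i : ι} (hi : α i ≠ 0) : 0 < w i := by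
  classical
  refine (hw.1 i).lt_of_ne' fun h0 => ?_
  -- If `w i = 0`, raising coordinate `i` to `T` leaves the right side at most `T - 1`, while the
  -- monomial is at least `T`.
  set T : ℝ := 1 + ∑ j, w j with hT
  have hs : 0 ≤ ∑ j, w j := Finset.sum_nonneg fun j _ => hw.1 j
  have h := hw.2 (Function.update 1 i T) fun j => by
    rcases eq_or_ne j i with rfl | hj
    · simp only [Function.update_self]
      linarith
    · simp [hj]
  have h1 : ∏ j, Function.update (1 : ι → ℝ) i T j ^ α j = T ^ α i := by
    rw [Finset.prod_eq_single i] <;> simp +contextual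
  have h2 : ∑ j, w j * Function.update (1 : ι → ℝ) i T j ^ m ≤ ∑ j, w j := by
    refine Finset.sum_le_sum fun j _ => ?_
    rcases eq_or_ne j i with rfl | hj
    · simp [h0]
    · simp [hj]
  have h3 : T ≤ T ^ α i := le_self_pow₀ (by linarith) hi
  linarith

theorem isSumSq_weights_sum_sub_prod {R : Type*} [CommRing R] [Algebra ℝ R] (hm : 0 < m)
    (hα : ∑ i, α i = m) {w : ι → ℝ} (hw : w ∈ agmWeights m α) (a : ι → R)
    (ha : ∀ i, IsSumSq (a i)) :
    IsSumSq (∑ i, algebraMap ℝ R (w i) * a i ^ m - ∏ i, a i ^ α i) := by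
  have hm' : (0 : ℝ) < m := by exact_mod_cast hm
  have hpos : ∀ i, α i ≠ 0 → 0 < w i := fun i hi => pos_of_mem_agmWeights hw hi
  -- Chosen so that `∑ w i * s i ^ m = 1`, whence `P ≤ 1`. Hurwitz for `a i / s i`, scaled by `P /
  -- m`, uses only the part `P * w i` of each weight with `α i ≠ 0`. If `α i = 0`, then `s i = 0`
  -- and `(s i)⁻¹ = 0`, harmless since only its zeroth power enters the products.
  set s : ι → ℝ := fun i => (α i / (m * w i)) ^ (m⁻¹ : ℝ)
  have hs : ∀ i, 0 ≤ s i := fun i => Real.rpow_nonneg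
    (div_nonneg (Nat.cast_nonneg _) (mul_nonneg hm'.le (hw.1 i))) _
  have hsm : ∀ i, s i ^ m = α i / (m * w i) := fun i => Real.rpow_inv_natCast_pow
    (div_nonneg (Nat.cast_nonneg _) (mul_nonneg hm'.le (hw.1 i))) hm.ne'
  have hspos : ∀ i, α i ≠ 0 → s i ≠ 0 := fun i hi h => by
    have h1 := hsm i
    have := hpos i hi
    rw [h, zero_pow hm.ne'] at h1
    have : (0 : ℝ) < α i / (m * w i) := by positivity
    linarith
  set P : ℝ := ∏ i, s i ^ α i
  have hP : P ≠ 0 := Finset.prod_ne_zero_iff.2 fun i _ => by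
    by_cases hi : α i = 0
    · simp [hi]
    · exact pow_ne_zero _ (hspos i hi)
  have hP0 : 0 ≤ P := Finset.prod_nonneg fun i _ => pow_nonneg (hs i) _
  have hP1 : P ≤ 1 := by
    refine (hw.2 s hs).trans_eq ?_
    calc ∑ i, w i * s i ^ m = ∑ i, (α i : ℝ) / m := by
          refine Finset.sum_congr rfl fun i _ => ?_
          rw [hsm]
          by_cases hi : α i = 0
          · simp [hi]
          · have := hpos i hi
            field_simp
      _ = 1 := by
          rw [← Finset.sum_div, ← Nat.cast_sum, hα, div_self hm'.ne']
  have h1 := isSumSq_weighted_sum_pow_sub_prod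
    (fun i => algebraMap ℝ R (s i)⁻¹ * a i)
    (fun i => (isSumSq_algebraMap (inv_nonneg.2 (hs i))).mul (ha i)) hα
  have h2 : IsSumSq (∑ i, algebraMap ℝ R (w i - P * (α i * (s i)⁻¹ ^ m / m)) * a i ^ m) := by
    refine IsSumSq.sum fun i _ => (isSumSq_algebraMap ?_).mul ((ha i).pow m)
    by_cases hi : α i = 0
    · simpa [hi] using hw.1 i
    · have hwi := hpos i hi
      have : (α i : ℝ) * (s i)⁻¹ ^ m / m = w i := by
        rw [inv_pow, hsm]
        field_simp
      rw [this]
      nlinarith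
  have h3 := ((isSumSq_algebraMap (R := R) (div_nonneg hP0 hm'.le)).mul h1).add h2
  refine Eq.mp (congrArg (fun z : R => IsSumSq z) ?_) h3
  have e1 : ∏ i, (algebraMap ℝ R (s i)⁻¹ * a i) ^ α i = algebraMap ℝ R P⁻¹ * ∏ i, a i ^ α i := by
    simp only [mul_pow, Finset.prod_mul_distrib, ← map_pow, ← map_prod, P, inv_pow,
      Finset.prod_inv_distrib]
  have e2 : algebraMap ℝ R (P / m) * ((m : R) * (algebraMap ℝ R P⁻¹ * ∏ i, a i ^ α i)) =
      ∏ i, a i ^ α i := by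
    rw [← map_natCast (algebraMap ℝ R) m, ← mul_assoc, ← mul_assoc, ← map_mul, ← map_mul,
      show P / m * m * P⁻¹ = 1 by field_simp, map_one, one_mul]
  symm
  rw [e1, mul_sub, e2, Finset.mul_sum, sub_add_eq_add_sub, ← Finset.sum_add_distrib]
  congr 1
  refine Finset.sum_congr rfl fun i _ => ?_
  rw [mul_pow, ← map_natCast (algebraMap ℝ R) (α i), ← map_pow, ← mul_assoc, ← mul_assoc,
    ← map_mul, ← map_mul, ← add_mul, ← map_add]
  congr 2
  ring

end Weights

/-! ### Sharing the diagonal among the monomials by convex separation. -/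

section Separation

variable {ι κ : Type*} [Fintype ι] [Fintype κ] {m : ℕ} {α : κ → ι → ℕ} {b : κ → ℝ} {c : ι → ℝ}

theorem exists_weights_sum_le_add (hm : 0 < m) (hα : ∀ k, ∑ i, α k i = m) (hb : ∀ k, 0 < b k)
    (h : ∀ v : ι → ℝ, (∀ i, 0 ≤ v i) → ∑ k, b k * ∏ i, v i ^ α k i ≤ ∑ i, c i * v i ^ m)
    {δ : ℝ} (hδ : 0 < δ) :
    ∃ w : κ → ι → ℝ, (∀ k, w k ∈ agmWeights m (α k)) ∧ ∀ i, ∑ k, b k * w k i ≤ c i + δ := by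
  classical
  -- The diagonals that can be shared out: a convex set, closed under increasing coordinates.
  set S : Set (ι → ℝ) :=
    {x | ∃ w : κ → ι → ℝ, (∀ k, w k ∈ agmWeights m (α k)) ∧ ∀ i, ∑ k, b k * w k i ≤ x i}
  have hS : Convex ℝ S := by
    rintro x ⟨w, hw, hwx⟩ x' ⟨w', hw', hwx'⟩ s t hs ht hst
    refine ⟨s • w + t • w', fun k => convex_agmWeights (hw k) (hw' k) hs ht hst, fun i => ?_⟩
    calc ∑ k, b k * (s • w + t • w') k i
        = s * ∑ k, b k * w k i + t * ∑ k, b k * w' k i := by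
          rw [Finset.mul_sum, Finset.mul_sum, ← Finset.sum_add_distrib]
          refine Finset.sum_congr rfl fun k _ => ?_
          simp only [Pi.add_apply, Pi.smul_apply, smul_eq_mul]
          ring
      _ ≤ s * x i + t * x' i :=
          add_le_add (mul_le_mul_of_nonneg_left (hwx i) hs) (mul_le_mul_of_nonneg_left (hwx' i) ht)
  suffices hc : c ∈ closure S by
    obtain ⟨x, ⟨w, hw, hwx⟩, hx⟩ := Metric.mem_closure_iff.1 hc δ hδ
    refine ⟨w, hw, fun i => (hwx i).trans ?_⟩
    have := (dist_le_pi_dist c x i).trans_lt hx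
    rw [Real.dist_eq, abs_lt] at this
    linarith
  by_contra hc
  obtain ⟨f, u, hfc, hfS⟩ := geometric_hahn_banach_point_closed hS.closure isClosed_closure hc
  set l : ι → ℝ := fun i => f fun j => if i = j then 1 else 0
  have hf : ∀ x, f x = ∑ i, x i * l i := fun x => f.toLinearMap.pi_apply_eq_sum_univ x
  -- Otherwise moving up in coordinate `i` inside `S` would push `f` below `u`.
  have hl : ∀ i, 0 ≤ l i := by
    intro i
    by_contra! hi
    have key : ∀ T : ℝ, 0 ≤ T → u < f (fun i => ∑ k, b k * (α k i / m : ℝ)) + T * l i := by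
      intro T hT
      rw [show f (fun i => ∑ k, b k * (α k i / m : ℝ)) + T * l i =
        f ((fun i => ∑ k, b k * (α k i / m : ℝ)) + T • fun j => if i = j then 1 else 0) by
          rw [map_add, map_smul, smul_eq_mul]]
      refine hfS _ (subset_closure ⟨fun k i => α k i / m, fun k => ?_, fun j => ?_⟩)
      · simpa using tangent_mem_agmWeights hm (hα k) (y := fun _ => 1) fun _ => one_pos
      · have : 0 ≤ T * (if i = j then 1 else 0) := by positivity
        simpa using this
    set F := f (fun i => ∑ k, b k * (α k i / m : ℝ))
    have h0 := key 0 le_rfl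
    have h1 := key ((F - u) / -l i) (div_nonneg (by linarith) (by linarith))
    have : (F - u) / -l i * l i = -(F - u) := by
      rw [div_neg, neg_mul, div_mul_cancel₀ _ hi.ne]
    linarith
  have hm' : (0 : ℝ) < m := by exact_mod_cast hm
  have key : ∀ ε : ℝ, 0 < ε → u ≤ f c + ε * ∑ i, c i := by
    intro ε hε
    have hlε : ∀ i, 0 < l i + ε := fun i => by linarith [hl i]
    -- With `y i ^ m` close to `l i`, the tangent weights at `y` give a point of `S` where `f` is at
    -- most the tail at `y`, so at most `∑ c i * y i ^ m`. The shift by `ε` keeps `y` positive where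
    -- `l i = 0`.
    set y : ι → ℝ := fun i => (l i + ε) ^ (m⁻¹ : ℝ)
    have hy : ∀ i, 0 < y i := fun i => Real.rpow_pos_of_pos (hlε i) _
    have hym : ∀ i, y i ^ m = l i + ε := fun i => Real.rpow_inv_natCast_pow (hlε i).le hm.ne'
    have h1 := hfS _ (subset_closure ⟨fun k i => α k i / m * (∏ j, y j ^ α k j) / y i ^ m,
      fun k => tangent_mem_agmWeights hm (hα k) hy, fun i => le_rfl⟩)
    have h2 := h y fun i => (hy i).le
    have h3 : ∑ i, c i * y i ^ m = f c + ε * ∑ i, c i := by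
      rw [hf, Finset.mul_sum, ← Finset.sum_add_distrib]
      exact Finset.sum_congr rfl fun i _ => by rw [hym]; ring
    rw [← h3]
    refine h1.le.trans (le_trans ?_ h2)
    simp only [hf, Finset.sum_mul]
    rw [Finset.sum_comm]
    refine Finset.sum_le_sum fun k _ => ?_
    have hP : 0 ≤ ∏ j, y j ^ α k j := Finset.prod_nonneg fun j _ => pow_nonneg (hy j).le _
    calc ∑ i, b k * (α k i / m * (∏ j, y j ^ α k j) / y i ^ m) * l i
        ≤ ∑ i, b k * (∏ j, y j ^ α k j) * (α k i / m) := by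
          refine Finset.sum_le_sum fun i _ => ?_
          rw [hym]
          have hle : l i / (l i + ε) ≤ 1 := (div_le_one (hlε i)).2 (by linarith)
          calc b k * (α k i / m * (∏ j, y j ^ α k j) / (l i + ε)) * l i
              = b k * (∏ j, y j ^ α k j) * (α k i / m) * (l i / (l i + ε)) := by ring
            _ ≤ _ := mul_le_of_le_one_right (by have := (hb k).le; positivity) hle
      _ = b k * ∏ j, y j ^ α k j := by
          rw [← Finset.mul_sum, ← Finset.sum_div, ← Nat.cast_sum, hα, div_self hm'.ne', mul_one]
  have hlim : Filter.Tendsto (fun ε : ℝ => f c + ε * ∑ i, c i) (nhdsWithin 0 (Set.Ioi 0))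
      (nhds (f c)) := by
    have : Continuous fun ε : ℝ => f c + ε * ∑ i, c i := by fun_prop
    simpa using (this.tendsto 0).mono_left nhdsWithin_le_nhds
  have := ge_of_tendsto hlim (Filter.eventually_of_mem self_mem_nhdsWithin key)
  linarith

/-- The slack is removed by compactness: since `b k > 0`, the diagonal bounds every weight, and the
nested sets with slack `1 / (N + 1)` have a common point. -/
theorem exists_weights_sum_le (hm : 0 < m) (hα : ∀ k, ∑ i, α k i = m) (hb : ∀ k, 0 < b k)
    (h : ∀ v : ι → ℝ, (∀ i, 0 ≤ v i) → ∑ k, b k * ∏ i, v i ^ α k i ≤ ∑ i, c i * v i ^ m) :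
    ∃ w : κ → ι → ℝ, (∀ k, w k ∈ agmWeights m (α k)) ∧ ∀ i, ∑ k, b k * w k i ≤ c i := by
  set K : ℕ → Set (κ → ι → ℝ) := fun N =>
    (⋂ k, {w | w k ∈ agmWeights m (α k)}) ∩ ⋂ i, {w | ∑ k, b k * w k i ≤ c i + 1 / (N + 1)}
  have hK : ∀ N w, w ∈ K N ↔
      (∀ k, w k ∈ agmWeights m (α k)) ∧ ∀ i, ∑ k, b k * w k i ≤ c i + 1 / (N + 1) := by
    simp [K]
  have hclosed : ∀ N, IsClosed (K N) := fun N =>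
    (isClosed_iInter fun k => isClosed_agmWeights.preimage (continuous_apply k)).inter
      (isClosed_iInter fun i => isClosed_le (by fun_prop) continuous_const)
  have hcompact : IsCompact (K 0) := by
    refine (isCompact_Icc (a := (0 : κ → ι → ℝ)) (b := fun k i => (c i + 1) / b k)).of_isClosed_subset
      (hclosed 0) fun w hw => ?_
    obtain ⟨h1, h2⟩ := (hK 0 w).1 hw
    refine ⟨fun k i => (h1 k).1 i, fun k i => ?_⟩
    rw [le_div_iff₀ (hb k), mul_comm]
    have h3 := Finset.single_le_sum (f := fun k => b k * w k i)
      (fun k _ => mul_nonneg (hb k).le ((h1 k).1 i)) (Finset.mem_univ k)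
    simpa using h3.trans (h2 i)
  obtain ⟨w, hw⟩ := IsCompact.nonempty_iInter_of_sequence_nonempty_isCompact_isClosed K
    (fun N w hw => by
      rw [hK] at hw ⊢
      refine ⟨hw.1, fun i => (hw.2 i).trans ?_⟩
      have : (1 : ℝ) / ((N + 1 : ℕ) + 1) ≤ 1 / (N + 1) :=
        one_div_le_one_div_of_le (by positivity) (by push_cast; linarith)
      linarith)
    (fun N => by
      obtain ⟨w, hw⟩ := exists_weights_sum_le_add hm hα hb h (Nat.one_div_pos_of_nat (n := N))
      exact ⟨w, (hK N w).2 hw⟩)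
    hcompact hclosed
  have hw' := fun N => (hK N w).1 (Set.mem_iInter.1 hw N)
  refine ⟨w, (hw' 0).1, fun i => ?_⟩
  have hlim := (tendsto_const_nhds (x := c i)).add (tendsto_one_div_add_atTop_nhds_zero_nat (𝕜 := ℝ))
  rw [add_zero] at hlim
  exact ge_of_tendsto' hlim fun N => (hw' N).2 i

/-- Positive semidefinite diagonal-minus-tail forms in squares are sums of squares. -/
theorem isSumSq_diagonal_sub_tail {R : Type*} [CommRing R] [Algebra ℝ R] (hm : 0 < m)
    (hα : ∀ k, ∑ i, α k i = m) (hb : ∀ k, 0 < b k)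
    (h : ∀ v : ι → ℝ, (∀ i, 0 ≤ v i) → ∑ k, b k * ∏ i, v i ^ α k i ≤ ∑ i, c i * v i ^ m)
    (a : ι → R) (ha : ∀ i, IsSumSq (a i)) :
    IsSumSq (∑ i, algebraMap ℝ R (c i) * a i ^ m -
      ∑ k, algebraMap ℝ R (b k) * ∏ i, a i ^ α k i) := by
  -- Each monomial receives its share `b k * w k`; the unused diagonal has nonnegative coefficients.
  obtain ⟨w, hw, hwc⟩ := exists_weights_sum_le hm hα hb h
  have h1 : IsSumSq (∑ i, algebraMap ℝ R (c i - ∑ k, b k * w k i) * a i ^ m) :=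
    IsSumSq.sum fun i _ => (isSumSq_algebraMap (sub_nonneg.2 (hwc i))).mul ((ha i).pow m)
  have h2 : IsSumSq (∑ k, algebraMap ℝ R (b k) *
      (∑ i, algebraMap ℝ R (w k i) * a i ^ m - ∏ i, a i ^ α k i)) :=
    IsSumSq.sum fun k _ => (isSumSq_algebraMap (hb k).le).mul
      (isSumSq_weights_sum_sub_prod hm (hα k) (hw k) a ha)
  refine Eq.mp (congrArg (fun z : R => IsSumSq z) ?_) (h1.add h2)
  simp only [map_sub, map_sum, map_mul, sub_mul, mul_sub, Finset.sum_sub_distrib, Finset.sum_mul,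
    Finset.mul_sum]
  rw [Finset.sum_comm (s := (Finset.univ : Finset ι))]
  simp only [mul_assoc]
  ring

end Separation

/-! ### From copositivity to sums of squares. -/

/-- A copositive form, with even powers substituted, is a sum of squares as soon as every mixed
monomial with a positive coefficient has no variable in common with another mixed monomial. -/
theorem isSumSq_of_copositive {ι R : Type*} [Fintype ι] [CommRing R] [Algebra ℝ R] {m : ℕ}
    (hm : 0 < m) {c : ι → ℝ} {M : Finset (ι →₀ ℕ)} {b : (ι →₀ ℕ) → ℝ}
    (hdeg : ∀ α ∈ M, ∑ i, α i = m) (hmixed : ∀ α ∈ M, ∀ i, α ≠ Finsupp.single i m)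
    (hdisj : ∀ α ∈ M, ∀ β ∈ M, 0 < b α → β ≠ α → b β ≠ 0 → Disjoint α.support β.support)
    (h : ∀ v : ι → ℝ, (∀ i, 0 ≤ v i) →
      0 ≤ ∑ i, c i * v i ^ m + ∑ α ∈ M, b α * ∏ i, v i ^ α i)
    (a : ι → R) (ha : ∀ i, IsSumSq (a i)) :
    IsSumSq (∑ i, algebraMap ℝ R (c i) * a i ^ m +
      ∑ α ∈ M, algebraMap ℝ R (b α) * ∏ i, a i ^ α i) := by
  classical
  have hc : ∀ i, 0 ≤ c i := by
    intro i
    have h1 := h (Pi.single i 1) fun j => by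
      rcases eq_or_ne j i with rfl | hj
      · simp
      · simp [hj]
    have h2 : ∀ α ∈ M, b α * ∏ j, (Pi.single i 1 : ι → ℝ) j ^ α j = 0 := by
      intro α hα
      obtain ⟨j, hj, hαj⟩ : ∃ j, j ≠ i ∧ α j ≠ 0 := by
        by_contra! hall
        refine hmixed α hα i (Finsupp.ext fun j => ?_)
        rcases eq_or_ne j i with rfl | hj
        · rw [Finsupp.single_eq_same, ← hdeg α hα]
          exact (Finset.sum_eq_single j (fun k _ hk => hall k hk) (by simp)).symm
        · rw [hall j hj, Finsupp.single_eq_of_ne hj]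
      rw [Finset.prod_eq_zero (Finset.mem_univ j), mul_zero]
      rw [Pi.single_eq_of_ne hj, zero_pow hαj]
    rw [Finset.sum_eq_zero h2, add_zero, Finset.sum_eq_single i] at h1
    · simpa using h1
    · intro j _ hj
      rw [Pi.single_eq_of_ne hj, zero_pow hm.ne', mul_zero]
    · simp
  have htail : ∀ v : ι → ℝ, (∀ i, 0 ≤ v i) →
      ∑ k : {α // α ∈ M.filter (b · < 0)}, -b k * ∏ i, v i ^ k.1 i ≤ ∑ i, c i * v i ^ m := by
    intro v hv
    -- Zeroing the variables of the positive monomials kills those monomials, spares the negative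
    -- ones by disjointness, and does not increase the diagonal part since `c ≥ 0`.
    set v' : ι → ℝ := fun j => if ∃ α ∈ M, 0 < b α ∧ α j ≠ 0 then 0 else v j with hv'
    have h0 : ∀ j, 0 ≤ v' j := fun j => by
      simp only [hv']
      split_ifs
      · exact le_rfl
      · exact hv j
    have hle : ∀ j, v' j ≤ v j := fun j => by
      simp only [hv']
      split_ifs
      · exact hv j
      · exact le_rfl
    have h1 := h v' h0
    have h2 : ∑ i, c i * v' i ^ m ≤ ∑ i, c i * v i ^ m := Finset.sum_le_sum fun i _ =>
      mul_le_mul_of_nonneg_left (pow_le_pow_left₀ (h0 i) (hle i) m) (hc i)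
    have h3 : ∑ α ∈ M, b α * ∏ i, v' i ^ α i =
        ∑ α ∈ M.filter (b · < 0), b α * ∏ i, v i ^ α i := by
      rw [Finset.sum_filter]
      refine Finset.sum_congr rfl fun α hα => ?_
      split_ifs with hbα
      · congr 1
        refine Finset.prod_congr rfl fun j _ => ?_
        by_cases hαj : α j = 0
        · simp [hαj]
        congr 1
        refine if_neg ?_
        rintro ⟨β, hβ, hbβ, hβj⟩
        have hne : α ≠ β := by
          rintro rfl
          exact lt_asymm hbα hbβ
        exact Finset.disjoint_left.1 (hdisj β hβ α hα hbβ hne hbα.ne)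
          (Finsupp.mem_support_iff.2 hβj) (Finsupp.mem_support_iff.2 hαj)
      · rcases (not_lt.1 hbα).eq_or_lt with hb0 | hb0
        · rw [← hb0, zero_mul]
        obtain ⟨j, hj⟩ : ∃ j, α j ≠ 0 := by
          by_contra! hall
          have := hdeg α hα
          simp only [hall, Finset.sum_const_zero] at this
          exact hm.ne this
        rw [Finset.prod_eq_zero (Finset.mem_univ j), mul_zero]
        rw [hv']
        simp only
        rw [if_pos ⟨α, hα, hb0, hj⟩, zero_pow hj]
    rw [Finset.sum_coe_sort (M.filter (b · < 0)) fun α => -b α * ∏ i, v i ^ α i]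
    simp only [neg_mul, Finset.sum_neg_distrib]
    linarith
  have h1 := isSumSq_diagonal_sub_tail (κ := {α // α ∈ M.filter (b · < 0)})
    (α := fun k i => k.1 i) (b := fun k => -b k) hm
    (fun k => hdeg k.1 (Finset.mem_filter.1 k.2).1)
    (fun k => neg_pos.2 (Finset.mem_filter.1 k.2).2) htail a ha
  rw [Finset.sum_coe_sort (M.filter (b · < 0))
    fun α => algebraMap ℝ R (-b α) * ∏ i, a i ^ α i] at h1
  have h2 : IsSumSq (∑ α ∈ M.filter (¬ b · < 0), algebraMap ℝ R (b α) * ∏ i, a i ^ α i) :=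
    IsSumSq.sum fun α hα => (isSumSq_algebraMap (not_lt.1 (Finset.mem_filter.1 hα).2)).mul
      (IsSumSq.prod fun i _ => (ha i).pow _)
  refine Eq.mp (congrArg (fun z : R => IsSumSq z) ?_) (h1.add h2)
  rw [← Finset.sum_filter_add_sum_filter_not M (b · < 0)]
  simp only [map_neg, neg_mul, Finset.sum_neg_distrib, sub_neg_eq_add, add_assoc]

/-! ### Extended Z-tensors and the feasible set of t. -/

namespace Tensor

theorem isHomogeneous_form {m n : ℕ} (A : Tensor m n) : A.form.IsHomogeneous m := by
  refine IsHomogeneous.sum _ _ _ fun i _ => ?_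
  have h := (isHomogeneous_C (Fin n) (A i)).mul
    (IsHomogeneous.prod Finset.univ (fun k => (X (i k) : MvPolynomial (Fin n) ℝ)) (fun _ => 1)
      fun k _ => isHomogeneous_X ℝ (i k))
  simpa using h

theorem form_squared_eq_aeval {m n : ℕ} (A : Tensor m n) :
    A.squared.form = aeval (fun i => (X i : MvPolynomial (Fin n) ℝ) ^ 2) A.form := by
  rw [form_squared, form]
  simp [algebraMap_eq]

/-- The mixed monomials of an extended `Z`-tensor, collected over all the blocks. -/
theorem IsExtendedZ.exists_mixed {m n : ℕ} (hm : 0 < m) {A : Tensor m n} (hA : A.IsExtendedZ) :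
    ∃ M : Finset (Fin n →₀ ℕ),
      (∀ α ∈ M, ∑ i, α i = m) ∧ (∀ α ∈ M, ∀ i, α ≠ Finsupp.single i m) ∧
      (∀ α ∈ M, ∀ β ∈ M, 0 < coeff α A.form → β ≠ α → coeff β A.form ≠ 0 →
        Disjoint α.support β.support) ∧
      A.form = ∑ i, monomial (Finsupp.single i m) (coeff (Finsupp.single i m) A.form) +
        ∑ α ∈ M, monomial α (coeff α A.form) := by
  obtain ⟨-, s, -, Γ, -, hΓ, hform, hsign⟩ := hA
  have hmem : ∀ l α, α ∈ mixedExponents m (Γ l) →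
      ∑ i, α i = m ∧ α.support ⊆ Γ l ∧ ∀ i, α ≠ Finsupp.single i m := by
    intro l α hα
    obtain ⟨h1, h2⟩ := Finset.mem_filter.1 hα
    obtain ⟨h3, h4⟩ := Finset.mem_finsuppAntidiag.1 h1
    refine ⟨?_, h4, h2⟩
    rw [← h3]
    refine (Finset.sum_subset (Finset.subset_univ _) fun i _ hi => ?_).symm
    exact Finsupp.notMem_support_iff.1 fun h => hi (h4 h)
  have hpart : ∀ l₁ l₂ α β, α ∈ mixedExponents m (Γ l₁) → β ∈ mixedExponents m (Γ l₂) →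
      l₁ ≠ l₂ → Disjoint α.support β.support := fun l₁ l₂ α β hα hβ hl =>
    (hΓ l₁ l₂ hl).mono (hmem l₁ α hα).2.1 (hmem l₂ β hβ).2.1
  refine ⟨Finset.univ.biUnion fun l => mixedExponents m (Γ l), ?_, ?_, ?_, ?_⟩
  · intro α hα
    obtain ⟨l, -, hl⟩ := Finset.mem_biUnion.1 hα
    exact (hmem l α hl).1
  · intro α hα
    obtain ⟨l, -, hl⟩ := Finset.mem_biUnion.1 hα
    exact (hmem l α hl).2.2
  · intro α hα β hβ hpos hne hβ0
    obtain ⟨l, -, hl⟩ := Finset.mem_biUnion.1 hα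
    obtain ⟨l', -, hl'⟩ := Finset.mem_biUnion.1 hβ
    rcases eq_or_ne l l' with rfl | hll
    · rcases hsign l with ⟨γ, hγ⟩ | hneg
      · have h1 : α = γ := by
          by_contra h
          exact hpos.ne' (hγ α hl h)
        have h2 : β = γ := by
          by_contra h
          exact hβ0 (hγ β hl' h)
        exact absurd (h2.trans h1.symm) hne
      · exact absurd hpos (hneg α hl).not_gt
    · exact hpart l l' α β hl hl' hll
  · rw [Finset.sum_biUnion]
    · exact hform
    · intro l _ l' _ hll
      refine Finset.disjoint_left.2 fun α hα hα' => ?_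
      -- An exponent lying in two blocks has support disjoint from itself, impossible for degree `m
      -- > 0`.
      have h0 : α = 0 := by simpa using hpart l l' α α hα hα' hll
      have h1 := (hmem l α hα).1
      simp only [h0, Finsupp.coe_zero, Pi.zero_apply, Finset.sum_const_zero] at h1
      exact hm.ne h1

/-- Forward, evaluate at `√(y i)`; backward, use `isSumSq_of_copositive` with `a i = X i ^ 2`. -/
theorem IsExtendedZ.mem_sosPolynomials_iff {m n : ℕ} (hm : 0 < m) {A : Tensor m n}
    (hA : A.IsExtendedZ) (t : ℝ) :
    C t * normPow n (2 * m) + A.squared.form ∈ sosPolynomials n (2 * m) ↔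
      ∀ y : Fin n → ℝ, (∀ i, 0 ≤ y i) → 0 ≤ t * ∑ i, y i ^ m + eval y A.form := by
  constructor
  · rintro ⟨-, r, q, hq⟩ y hy
    have h := congrArg (eval fun i => √(y i)) hq
    have hnonneg : 0 ≤ eval (fun i => √(y i)) (∑ k, q k ^ 2) := by
      rw [map_sum]
      exact Finset.sum_nonneg fun k _ => by rw [map_pow]; exact sq_nonneg _
    rw [← h] at hnonneg
    convert hnonneg using 1
    have h2 : ∀ i, √(y i) ^ 2 = y i := fun i => Real.sq_sqrt (hy i)
    rw [form_squared, form]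
    simp [normPow, pow_mul, h2]
  · intro h
    refine ⟨?_, ?_⟩
    · refine IsHomogeneous.totalDegree_le (IsHomogeneous.add ?_ A.squared.isHomogeneous_form)
      have h1 : (normPow n (2 * m)).IsHomogeneous (2 * m) :=
        IsHomogeneous.sum _ _ _ fun i _ => by simpa using (isHomogeneous_X ℝ i).pow (2 * m)
      simpa using (isHomogeneous_C (Fin n) t).mul h1
    · obtain ⟨M, hdeg, hmixed, hdisj, hform⟩ := hA.exists_mixed hm
      -- Needed twice: in `ℝ` for the inequality and in the polynomial ring for the sum of squares.
      have key : ∀ {R : Type} [CommRing R] [Algebra ℝ R] (a : Fin n → R),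
          algebraMap ℝ R t * ∑ i, a i ^ m + aeval a A.form =
            ∑ i, algebraMap ℝ R (t + coeff (Finsupp.single i m) A.form) * a i ^ m +
              ∑ α ∈ M, algebraMap ℝ R (coeff α A.form) * ∏ i, a i ^ α i := by
        intro R _ _ a
        have e : aeval a A.form =
            ∑ i, algebraMap ℝ R (coeff (Finsupp.single i m) A.form) * a i ^ m +
              ∑ α ∈ M, algebraMap ℝ R (coeff α A.form) * ∏ i, a i ^ α i := by
          conv_lhs => rw [hform]
          simp only [map_add, map_sum, aeval_monomial]
          refine congrArg₂ (· + ·) (Finset.sum_congr rfl fun i _ => ?_)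
            (Finset.sum_congr rfl fun α _ => ?_)
          · rw [Finsupp.prod_single_index (h := fun i k => a i ^ k) (pow_zero _)]
          · rw [Finsupp.prod_fintype _ _ fun i => pow_zero _]
        rw [e, ← add_assoc, Finset.mul_sum, ← Finset.sum_add_distrib]
        simp only [map_add, add_mul]
      refine IsSumSq.exists_eq_sum_fin ?_
      have h1 := isSumSq_of_copositive hm
        (c := fun i => t + coeff (Finsupp.single i m) A.form) hdeg hmixed hdisj
        (fun v hv => by simpa [coe_aeval_eq_eval] using (h v hv).trans_eq (key v))
        (fun i => (X i : MvPolynomial (Fin n) ℝ) ^ 2) fun i => (IsSquare.sq _).isSumSq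
      rw [← key, ← form_squared_eq_aeval] at h1
      simpa only [normPow, pow_mul, algebraMap_eq] using h1

theorem eval_form {m n : ℕ} (A : Tensor m n) (y : Fin n → ℝ) :
    eval y A.form = ∑ i, A i * ∏ k, y (i k) := by
  simp [form]

/-- Each monomial is at most the `m`-th power of its largest variable. This makes `t = ∑ |A i|`
feasible. -/
theorem neg_sum_abs_mul_le_eval_form {m n : ℕ} (A : Tensor m n) (hm : 0 < m) {y : Fin n → ℝ}
    (hy : ∀ i, 0 ≤ y i) : -((∑ i, |A i|) * ∑ j, y j ^ m) ≤ eval y A.form := by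
  rw [eval_form, Finset.sum_mul, ← Finset.sum_neg_distrib]
  refine Finset.sum_le_sum fun i _ => ?_
  have hP : 0 ≤ ∏ k, y (i k) := Finset.prod_nonneg fun k _ => hy _
  have h1 : ∏ k, y (i k) ≤ ∑ j, y j ^ m := by
    have hne : (Finset.univ : Finset (Fin m)).Nonempty := ⟨⟨0, hm⟩, Finset.mem_univ _⟩
    obtain ⟨k, -, hk⟩ := Finset.exists_max_image Finset.univ (fun k => y (i k)) hne
    calc ∏ k, y (i k) ≤ ∏ _k : Fin m, y (i k) :=
          Finset.prod_le_prod (fun k _ => hy _) fun k' hk' => hk k' hk'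
      _ = y (i k) ^ m := by simp
      _ ≤ _ := Finset.single_le_sum (f := fun j => y j ^ m)
          (fun j _ => pow_nonneg (hy j) m) (Finset.mem_univ (i k))
  nlinarith [neg_abs_le (A i), mul_le_mul_of_nonneg_left h1 (abs_nonneg (A i)),
    mul_le_mul_of_nonneg_right (neg_abs_le (A i)) hP]

end Tensor

theorem corollary5p1 (m n : ℕ) (hm : 0 < m) (hn : 0 < n) (A : Tensor m n) (hA : A.IsExtendedZ) :
    ∃ v : ℝ,
      IsLeast {t : ℝ | MvPolynomial.C t * normPow n (2 * m) + A.squared.form ∈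
        sosPolynomials n (2 * m)} v ∧
      (A.IsCopositive ↔ v ≤ 0) := by
  set S : Set ℝ := {t : ℝ | MvPolynomial.C t * normPow n (2 * m) + A.squared.form ∈
    sosPolynomials n (2 * m)}
  have hS : ∀ t, t ∈ S ↔ ∀ y : Fin n → ℝ, (∀ i, 0 ≤ y i) →
      0 ≤ t * ∑ i, y i ^ m + eval y A.form := hA.mem_sosPolynomials_iff hm
  have hclosed : IsClosed S := by
    have : S = ⋂ y : Fin n → ℝ, ⋂ _ : ∀ i, 0 ≤ y i,
        {t | 0 ≤ t * ∑ i, y i ^ m + eval y A.form} := by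
      ext t
      simp [hS]
    rw [this]
    exact isClosed_iInter fun y => isClosed_iInter fun _ =>
      isClosed_le continuous_const (by fun_prop)
  have hne : S.Nonempty := ⟨∑ i, |A i|, (hS _).2 fun y hy => by
    linarith [A.neg_sum_abs_mul_le_eval_form hm hy]⟩
  have hbdd : BddBelow S := by
    -- The bound comes from the all-ones vector, where `∑ y i ^ m = n`.
    refine ⟨-eval (fun _ => 1) A.form / n, fun t ht => ?_⟩
    have h := (hS t).1 ht (fun _ => 1) fun _ => zero_le_one
    have hn' : (0 : ℝ) < n := by exact_mod_cast hn
    rw [div_le_iff₀ hn']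
    simp at h
    linarith
  have hleast : IsLeast S (sInf S) := hclosed.isLeast_csInf hne hbdd
  refine ⟨sInf S, hleast, fun h => hleast.2 ((hS 0).2 fun y hy => ?_), fun h y hy => ?_⟩
  · simpa using h y hy
  · have h1 := (hS _).1 hleast.1 y hy
    have h2 : 0 ≤ ∑ i, y i ^ m := Finset.sum_nonneg fun i _ => pow_nonneg (hy i) m
    linarith [mul_nonpos_of_nonpos_of_nonneg h h2]
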